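/- **Conventions.** A *simplicial complex* $\Delta$ on a finite set $V$ is a family of subsets of $V$ (its *faces*) closed under taking subsets; $\emptyset$ may be a face, and the void complex (no faces) is allowed. Facets are the inclusion-maximal faces, a vertex is a face $\{v\}$, and $\Delta$ is *pure* if all its facets have the same cardinality. For $I\subseteq V$ put $$\mathrm{del}_\Delta(I)=\{J\in\Delta : I\not\subseteq J\},\qquad \mathrm{star}_\Delta(I)=\{J\in\Delta : I\cup J\in\Delta\},$$ $$\mathrm{link}_\Delta(I)=\{J\in\Delta : I\cup J\in\Delta,\ I\cap J=\emptyset\},$$ $$\mathrm{costar}_\Delta(I)=\{J\in\Delta : J\subseteq F \text{ for some facet } F \text{ of } \Delta \text{ with } I\not\subseteq F\}.$$ A complex is a *simplex* if it consists of all subsets of one set $F\subseteq V$; the void complex also counts as a simplex. A complex is *vertex decomposable* if it is a simplex, or if it is pure and has a vertex $v$ such that $\mathrm{del}_\Delta(\{v\})$ and $\mathrm{link}_\Delta(\{v\})$ are both vertex decomposable. It is *strongly vertex decomposable* if $\mathrm{costar}_\Delta(I)$ and $\mathrm{star}_\Delta(I)$ are vertex decomposable for every face $I$ (including $I=\emptyset$).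 It is *spherical* if it is not void and its geometric realization $\bigcup_{I\in\Delta}\mathrm{conv}\{e_i : i\in I\}\subset\mathbb{R}^V$ is homeomorphic to a sphere $S^{n-1}\subset\mathbb R^n$ for some $n\ge 0$ (with $S^{-1}=\emptyset$). Let $(W,S)$ be a Coxeter system with $S$ finite, $Q=(q_1,\dots,q_r)$ a word in $S$, and $\pi\in W$. The *subword complex* $\mathcal{SC}(Q,\pi)$ is the simplicial complex on $\{1,\dots,r\}$ whose facets are the sets $I$ such that the subword of $Q$ formed by the letters at the positions outside $I$ is a reduced expression of $\pi$. It is of *infinite type* if $W$ is infinite. **Proposition.** The following two statements are equivalent. 1. For every spherical subword complex $\mathcal{SC}(Q,\pi)$ of infinite type and every vertex $\{i\}$ of it, the deletion $\mathrm{del}_{\mathcal{SC}(Q,\pi)}(\{i\})$ is vertex decomposable. 2. Every spherical subword complex $\mathcal{SC}(Q,\pi)$ of infinite type is strongly vertex decomposable. -/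

import Mathlib

universe u v

/-- A simplicial complex on the ground set `V`: a family of finite subsets of `V` (the faces) that
is closed under taking subsets. The empty set is allowed as a face, so that the void complex `⊥`
(no faces at all) and the complex `{∅}` are different. Elements of `V` need not be vertices. -/
abbrev FaceComplex (V : Type*) : Type _ := LowerSet (Finset V)

namespace FaceComplex

variable {V : Type*}

/-- The facets are the faces that are maximal with respect to inclusion. -/
def IsFacet (Δ : FaceComplex V) (F : Finset V) : Prop :=
  Maximal (fun J => J ∈ Δ) F

/-- A complex is pure if all its facets have the same dimension. -/
def IsPure (Δ : FaceComplex V) : Prop :=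
  ∀ F G : Finset V, Δ.IsFacet F → Δ.IsFacet G → F.card = G.card

/-- A simplex: the complex of all subsets of one finite set. The void complex is counted as a
simplex as well. -/
def IsSimplex (Δ : FaceComplex V) : Prop :=
  Δ = ⊥ ∨ ∃ F : Finset V, Δ = LowerSet.Iic F

/-- The deletion of `I`: all faces that do not contain `I`. -/
def deletion (Δ : FaceComplex V) (I : Finset V) : FaceComplex V where
  carrier := {J | J ∈ Δ ∧ ¬ I ⊆ J}
  lower' := fun _ _ hba ha => ⟨Δ.lower hba ha.1, fun h => ha.2 (h.trans hba)⟩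

/-- The costar of `I`: the complex generated by the facets that do not contain `I`. -/
def costar (Δ : FaceComplex V) (I : Finset V) : FaceComplex V where
  carrier := {J | J ∈ Δ ∧ ∃ F : Finset V, Δ.IsFacet F ∧ J ⊆ F ∧ ¬ I ⊆ F}
  lower' := fun _ _ hba ha =>
    ⟨Δ.lower hba ha.1, ha.2.imp fun _ hF => ⟨hF.1, Finset.Subset.trans hba hF.2.1, hF.2.2⟩⟩

section

variable [DecidableEq V]

/-- The star of `I`: all faces whose union with `I` is a face. -/
def star (Δ : FaceComplex V) (I : Finset V) : FaceComplex V where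
  carrier := {J | J ∈ Δ ∧ I ∪ J ∈ Δ}
  lower' := fun _ _ hba ha =>
    ⟨Δ.lower hba ha.1, Δ.lower (Finset.union_subset_union_right hba) ha.2⟩

/-- The link of `I`: all faces of the star of `I` that are disjoint from `I`. -/
def link (Δ : FaceComplex V) (I : Finset V) : FaceComplex V where
  carrier := {J | J ∈ Δ ∧ I ∪ J ∈ Δ ∧ I ∩ J = ∅}
  lower' := fun _ _ hba ha =>
    ⟨Δ.lower hba ha.1, Δ.lower (Finset.union_subset_union_right hba) ha.2.1,
      Finset.subset_empty.mp ((Finset.inter_subset_inter_left hba).trans ha.2.2.subset)⟩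

/-- Vertex decomposable complexes: a simplex, or a pure complex with a vertex whose deletion and
link are both vertex decomposable. -/
inductive VertexDecomposable : FaceComplex V → Prop
  | of_isSimplex (Δ : FaceComplex V) (h : Δ.IsSimplex) : VertexDecomposable Δ
  | of_vertex (Δ : FaceComplex V) (v : V) (hpure : Δ.IsPure) (hv : {v} ∈ Δ)
      (hdel : VertexDecomposable (Δ.deletion {v}))
      (hlink : VertexDecomposable (Δ.link {v})) : VertexDecomposable Δ

/-- Strongly vertex decomposable complexes: the costar and the star of every face (the empty face
included) are vertex decomposable. -/
def StronglyVertexDecomposable (Δ : FaceComplex V) : Prop :=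
  ∀ I : Finset V, I ∈ Δ →
    VertexDecomposable (Δ.costar I) ∧ VertexDecomposable (Δ.star I)

/-- The standard geometric realization in `ℝ^V` (`V` finite): the union over all faces `I` of the
convex hull of the standard basis vectors `e_i`, `i ∈ I`. -/
def realization (Δ : FaceComplex V) : Set (V → ℝ) :=
  ⋃ I ∈ Δ, convexHull ℝ ((fun i : V => (Pi.single i 1 : V → ℝ)) '' (I : Set V))

/-- A complex on a finite ground set is spherical if it is not void and its geometric realization
is homeomorphic to a unit sphere in some `ℝ^n`. For `n = 0` this is the empty sphere of
dimension `-1`, the realization of the complex `{∅}`. -/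
def IsSpherical [Finite V] (Δ : FaceComplex V) : Prop :=
  Δ ≠ ⊥ ∧ ∃ n : ℕ,
    Nonempty (Δ.realization ≃ₜ Metric.sphere (0 : EuclideanSpace ℝ (Fin n)) 1)

end

end FaceComplex

namespace CoxeterSystem

variable {B W : Type*} [Group W] {M : CoxeterMatrix B}

/-- The subword `Q_J` of the word `Q = (q_1, …, q_r)`, consisting of the letters with position in
`J`, in their order. -/
def subword {r : ℕ} (Q : Fin r → B) (J : Finset (Fin r)) : List B :=
  ((List.finRange r).filter (fun i => i ∈ J)).map Q

/-- `ω` is a reduced expression for `w`. -/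
def IsReducedExpression (cs : CoxeterSystem M W) (ω : List B) (w : W) : Prop :=
  cs.IsReduced ω ∧ cs.wordProd ω = w

/-- The subword complex of the word `Q` and the group element `w`: the complex generated by the
sets `I` of positions such that the subword on the complement of `I` is a reduced expression
for `w`. -/
def subwordComplex (cs : CoxeterSystem M W) {r : ℕ} (Q : Fin r → B) (w : W) :
    FaceComplex (Fin r) where
  carrier := {J | ∃ I : Finset (Fin r), J ⊆ I ∧ cs.IsReducedExpression (subword Q Iᶜ) w}
  lower' := fun _ _ hba ha => ha.imp fun _ hI => ⟨Finset.Subset.trans hba hI.1, hI.2⟩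

end CoxeterSystem

/-! ### Deletions, links, stars and costars of face complexes. -/

namespace FaceComplex

variable {V : Type*}

/-! The link between the two statements is a combinatorial property of spherical complexes,
`HasOppositeFacets`: no ridge lies in just one facet. It makes the costar of a vertex equal to its
deletion, so 2 implies 1 at once.

For 1 implies 2, stars are no obstacle: every subword complex is vertex decomposable (its last
position can be shed, by the exchange condition), and vertex decomposability passes to stars.
Costars are treated by induction on the face `I`: a vertex `v` of a face `I` with at least two
elements can be shed from the costar, with deletion `Δ.deletion {v}`, decomposable by 1, and link
the costar of `I \ {v}` in `Δ.link {v}`. The induction runs over pure complexes with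
`HasOppositeFacets` and decomposable vertex deletions, a class closed under links, unlike that of
subword complexes of infinite type.

That spheres have `HasOppositeFacets` is topology: a ridge in only one facet can be pushed off
through that facet, so the identity is homotopic to a map that is not onto. On a sphere such a map
is nullhomotopic, against the no-retraction theorem, which is proved by a volume computation. -/

/-- Every ridge of a facet is contained in a facet that avoids the omitted vertex. -/
def HasOppositeFacets [DecidableEq V] (Δ : FaceComplex V) : Prop :=
  ∀ F : Finset V, Δ.IsFacet F → ∀ i ∈ F, ∃ G : Finset V, Δ.IsFacet G ∧ F.erase i ⊆ G ∧ i ∉ G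

theorem mem_deletion {Δ : FaceComplex V} {I J : Finset V} :
    J ∈ Δ.deletion I ↔ J ∈ Δ ∧ ¬ I ⊆ J := Iff.rfl

theorem mem_deletion_singleton {Δ : FaceComplex V} {v : V} {J : Finset V} :
    J ∈ Δ.deletion {v} ↔ J ∈ Δ ∧ v ∉ J := by
  simp [mem_deletion]

theorem deletion_singleton_eq_self {Δ : FaceComplex V} {v : V} (h : {v} ∉ Δ) :
    Δ.deletion {v} = Δ := by
  ext J
  exact mem_deletion_singleton.trans
    (and_iff_left_of_imp fun hJ hv => h (Δ.lower (Finset.singleton_subset_iff.mpr hv) hJ))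

theorem mem_costar {Δ : FaceComplex V} {I J : Finset V} :
    J ∈ Δ.costar I ↔ J ∈ Δ ∧ ∃ F : Finset V, Δ.IsFacet F ∧ J ⊆ F ∧ ¬ I ⊆ F := Iff.rfl

theorem exists_isFacet_superset [Finite V] {Δ : FaceComplex V} {J : Finset V} (hJ : J ∈ Δ) :
    ∃ F : Finset V, Δ.IsFacet F ∧ J ⊆ F := by
  obtain ⟨F, hJF, hF⟩ := (Set.toFinite {K : Finset V | K ∈ Δ}).exists_le_maximal hJ
  exact ⟨F, hF, hJF⟩

theorem IsSimplex.isPure {Δ : FaceComplex V} (h : Δ.IsSimplex) : Δ.IsPure := by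
  rcases h with rfl | ⟨S, rfl⟩
  · intro F G hF
    exact absurd hF.1 (by simp)
  · have key : ∀ F : Finset V, IsFacet (LowerSet.Iic S) F → F = S := fun F hF =>
      le_antisymm hF.1 (hF.2 (y := S) (LowerSet.mem_Iic_iff.mpr le_rfl) hF.1)
    intro F G hF hG
    rw [key F hF, key G hG]

theorem isFacet_costar {Δ : FaceComplex V} {I F : Finset V} (h : (Δ.costar I).IsFacet F) :
    Δ.IsFacet F ∧ ¬ I ⊆ F := by
  obtain ⟨-, G, hG, hFG, hIG⟩ := h.1
  have : F = G := le_antisymm hFG (h.2 (y := G) ⟨hG.1, G, hG, subset_rfl, hIG⟩ hFG)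
  exact this ▸ ⟨hG, hIG⟩

theorem IsPure.costar {Δ : FaceComplex V} (h : Δ.IsPure) (I : Finset V) :
    (Δ.costar I).IsPure :=
  fun F G hF hG => h F G (isFacet_costar hF).1 (isFacet_costar hG).1

theorem costar_empty (Δ : FaceComplex V) : Δ.costar ∅ = ⊥ := by
  ext J
  simp [costar]

variable [DecidableEq V]

theorem VertexDecomposable.isPure {Δ : FaceComplex V} (h : Δ.VertexDecomposable) :
    Δ.IsPure := by
  cases h with
  | of_isSimplex _ h => exact h.isPure
  | of_vertex _ _ h => exact h

theorem mem_link_singleton {Δ : FaceComplex V} {v : V} {J : Finset V} :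
    J ∈ Δ.link {v} ↔ insert v J ∈ Δ ∧ v ∉ J := by
  constructor
  · rintro ⟨-, h, h'⟩
    refine ⟨by rwa [Finset.singleton_union] at h, fun hv => ?_⟩
    simp [hv] at h'
  · rintro ⟨h, h'⟩
    exact ⟨Δ.lower (Finset.subset_insert v J) h, by rwa [Finset.singleton_union],
      Finset.singleton_inter_of_notMem h'⟩

theorem mem_star {Δ : FaceComplex V} {I J : Finset V} : J ∈ Δ.star I ↔ I ∪ J ∈ Δ :=
  ⟨fun h => h.2, fun h => ⟨Δ.lower Finset.subset_union_right h, h⟩⟩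

theorem link_singleton_eq_bot {Δ : FaceComplex V} {v : V} (h : {v} ∉ Δ) : Δ.link {v} = ⊥ := by
  ext J
  refine mem_link_singleton.trans (iff_of_false (fun hJ => h (Δ.lower ?_ hJ.1)) (by simp))
  simp

theorem link_deletion_singleton (Δ : FaceComplex V) {v w : V} (h : v ≠ w) :
    (Δ.deletion {v}).link {w} = (Δ.link {w}).deletion {v} := by
  ext J
  change J ∈ (Δ.deletion {v}).link {w} ↔ J ∈ (Δ.link {w}).deletion {v}
  simp only [mem_link_singleton, mem_deletion_singleton, Finset.mem_insert]
  tauto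

theorem link_link_singleton (Δ : FaceComplex V) {v w : V} (h : v ≠ w) :
    (Δ.link {v}).link {w} = (Δ.link {w}).link {v} := by
  ext J
  change J ∈ (Δ.link {v}).link {w} ↔ J ∈ (Δ.link {w}).link {v}
  simp only [mem_link_singleton, Finset.mem_insert, Finset.insert_comm v w]
  tauto

theorem isFacet_link_singleton_iff {Δ : FaceComplex V} {v : V} {F : Finset V} :
    (Δ.link {v}).IsFacet F ↔ Δ.IsFacet (insert v F) ∧ v ∉ F := by
  constructor
  · rintro ⟨h, hmax⟩
    obtain ⟨h1, h2⟩ := mem_link_singleton.mp h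
    refine ⟨⟨h1, fun G hG hFG => ?_⟩, h2⟩
    have hv : v ∈ G := hFG (Finset.mem_insert_self v F)
    have := hmax (y := G.erase v)
      (mem_link_singleton.mpr ⟨by rwa [Finset.insert_erase hv], Finset.notMem_erase v G⟩)
      (Finset.subset_erase.mpr ⟨(Finset.subset_insert v F).trans hFG, h2⟩)
    exact (Finset.subset_insert_iff).mpr this
  · rintro ⟨⟨h, hmax⟩, h2⟩
    refine ⟨mem_link_singleton.mpr ⟨h, h2⟩, fun G hG hFG => ?_⟩
    obtain ⟨hG1, hG2⟩ := mem_link_singleton.mp hG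
    have := hmax hG1 (Finset.insert_subset_insert v hFG)
    exact (Finset.insert_subset_insert_iff hG2).mp this

theorem IsPure.link_singleton {Δ : FaceComplex V} (h : Δ.IsPure) (v : V) :
    (Δ.link {v}).IsPure := by
  intro F G hF hG
  obtain ⟨hF, hvF⟩ := isFacet_link_singleton_iff.mp hF
  obtain ⟨hG, hvG⟩ := isFacet_link_singleton_iff.mp hG
  have := h _ _ hF hG
  rwa [Finset.card_insert_of_notMem hvF, Finset.card_insert_of_notMem hvG,
    Nat.add_right_cancel_iff] at this

theorem IsSimplex.link_singleton {Δ : FaceComplex V} (h : Δ.IsSimplex) (v : V) :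
    (Δ.link {v}).IsSimplex := by
  by_cases hv : {v} ∈ Δ
  · rcases h with rfl | ⟨S, rfl⟩
    · exact absurd hv (by simp)
    · have hvS : v ∈ S := by simpa using hv
      refine Or.inr ⟨S.erase v, ?_⟩
      ext J
      refine mem_link_singleton.trans ?_
      simp [Finset.subset_erase, Finset.insert_subset_iff, hvS]
  · exact Or.inl (link_singleton_eq_bot hv)

/-- Taking the link at `v` commutes with deletion and link at the shed vertex `w`, so `w` can still
be shed. If `w` is no vertex of the link, deleting it there changes nothing and the induction
hypothesis for the deletion suffices. -/
theorem VertexDecomposable.link_singleton {Δ : FaceComplex V} (h : Δ.VertexDecomposable) (v : V) :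
    (Δ.link {v}).VertexDecomposable := by
  induction h with
  | of_isSimplex Δ h => exact .of_isSimplex _ (h.link_singleton v)
  | of_vertex Δ w hpure hw hdel hlink ihdel ihlink =>
    obtain rfl | hne := eq_or_ne v w
    · exact hlink
    by_cases hmem : {w} ∈ Δ.link {v}
    · refine .of_vertex _ w (hpure.link_singleton v) hmem ?_ ?_
      · rwa [← link_deletion_singleton Δ hne.symm]
      · rwa [link_link_singleton Δ hne]
    · rwa [link_deletion_singleton Δ hne.symm, deletion_singleton_eq_self hmem] at ihdel

theorem isFacet_of_isFacet_star {Δ : FaceComplex V} {I F : Finset V}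
    (h : (Δ.star I).IsFacet F) : Δ.IsFacet F := by
  have hIF : I ⊆ F := by
    have := h.2 (y := I ∪ F) (mem_star.mpr (by simpa [← Finset.union_assoc] using h.1.2))
      Finset.subset_union_right
    exact Finset.subset_union_left.trans this
  refine ⟨h.1.1, fun G hG hFG => h.2 (mem_star.mpr ?_) hFG⟩
  rwa [Finset.union_eq_right.mpr (hIF.trans hFG)]

theorem IsPure.star {Δ : FaceComplex V} (h : Δ.IsPure) (I : Finset V) : (Δ.star I).IsPure :=
  fun F G hF hG => h F G (isFacet_of_isFacet_star hF) (isFacet_of_isFacet_star hG)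

/-- The star is a cone with apex any `v` in the face: deletion and link of `v` are both the star of
the remaining face in the link of `v`. -/
theorem VertexDecomposable.star {Δ : FaceComplex V} (h : Δ.VertexDecomposable) {I : Finset V}
    (hI : I ∈ Δ) : (Δ.star I).VertexDecomposable := by
  induction I using Finset.induction_on generalizing Δ with
  | empty =>
    convert h
    ext J
    exact mem_star.trans (by simp)
  | insert v I hv ih =>
    have hlink := ih (h.link_singleton v) (mem_link_singleton.mpr ⟨hI, hv⟩)
    have h1 : (Δ.star (insert v I)).link {v} = (Δ.link {v}).star I := by
      ext J
      change J ∈ (Δ.star (insert v I)).link {v} ↔ J ∈ (Δ.link {v}).star I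
      simp [mem_link_singleton, mem_star, hv]
    have h2 : (Δ.star (insert v I)).deletion {v} = (Δ.link {v}).star I := by
      ext J
      change J ∈ (Δ.star (insert v I)).deletion {v} ↔ J ∈ (Δ.link {v}).star I
      simp [mem_deletion_singleton, mem_link_singleton, mem_star, hv]
    refine .of_vertex _ v (h.isPure.star _) (mem_star.mpr ?_) (h2 ▸ hlink) (h1 ▸ hlink)
    rwa [Finset.union_eq_left.mpr (by simp)]

theorem HasOppositeFacets.link_singleton {Δ : FaceComplex V} (h : Δ.HasOppositeFacets) (v : V) :
    (Δ.link {v}).HasOppositeFacets := by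
  intro F hF i hi
  obtain ⟨hF, hv⟩ := isFacet_link_singleton_iff.mp hF
  have hiv : v ≠ i := fun hvi => hv (hvi ▸ hi)
  obtain ⟨G, hG, hFG, hiG⟩ := h _ hF i (Finset.mem_insert_of_mem hi)
  have hvG : v ∈ G := hFG (by simp [hiv])
  refine ⟨G.erase v, isFacet_link_singleton_iff.mpr
    ⟨by rwa [Finset.insert_erase hvG], Finset.notMem_erase v G⟩, ?_, by simp [hiG]⟩
  refine Finset.subset_erase.mpr ⟨fun x hx => hFG ?_, fun hx => hv (Finset.mem_of_mem_erase hx)⟩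
  simp only [Finset.mem_erase, Finset.mem_insert] at hx ⊢
  tauto

theorem HasOppositeFacets.exists_isFacet [Finite V] {Δ : FaceComplex V}
    (h : Δ.HasOppositeFacets) {J : Finset V} (hJ : J ∈ Δ) {i : V} (hi : i ∉ J) :
    ∃ F : Finset V, Δ.IsFacet F ∧ J ⊆ F ∧ i ∉ F := by
  obtain ⟨F, hF, hJF⟩ := exists_isFacet_superset hJ
  by_cases hiF : i ∈ F
  · obtain ⟨G, hG, hFG, hiG⟩ := h F hF i hiF
    exact ⟨G, hG, (Finset.subset_erase.mpr ⟨hJF, hi⟩).trans hFG, hiG⟩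
  · exact ⟨F, hF, hJF, hiF⟩

/-- A face avoiding `i` might lie only in facets through `i`; crossing a ridge out of such a facet
supplies one that avoids `i`. -/
theorem HasOppositeFacets.costar_singleton [Finite V] {Δ : FaceComplex V}
    (h : Δ.HasOppositeFacets) (i : V) : Δ.costar {i} = Δ.deletion {i} := by
  ext J
  change J ∈ Δ.costar {i} ↔ J ∈ Δ.deletion {i}
  simp only [mem_costar, mem_deletion_singleton, Finset.singleton_subset_iff]
  constructor
  · rintro ⟨hJ, F, -, hJF, hi⟩
    exact ⟨hJ, fun hiJ => hi (hJF hiJ)⟩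
  · rintro ⟨hJ, hi⟩
    exact ⟨hJ, h.exists_isFacet hJ hi⟩

theorem HasOppositeFacets.vertexDecomposable_costar [Finite V] {Δ : FaceComplex V}
    (h : Δ.HasOppositeFacets) (hpure : Δ.IsPure)
    (hdel : ∀ i : V, {i} ∈ Δ → (Δ.deletion {i}).VertexDecomposable) {I : Finset V} (hI : I ∈ Δ) :
    (Δ.costar I).VertexDecomposable := by
  induction I using Finset.induction_on generalizing Δ with
  | empty => exact .of_isSimplex _ (Or.inl Δ.costar_empty)
  | insert v I hv ih =>
    have hvΔ : {v} ∈ Δ := Δ.lower (by simp) hI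
    obtain rfl | ⟨j, hj⟩ := I.eq_empty_or_nonempty
    · rw [LawfulSingleton.insert_empty_eq, h.costar_singleton]
      exact hdel v hvΔ
    have hjv : j ≠ v := fun hjv => hv (hjv ▸ hj)
    have hlink : ((Δ.link {v}).costar I).VertexDecomposable := by
      refine ih (h.link_singleton v) (hpure.link_singleton v) (fun i hi => ?_)
        (mem_link_singleton.mpr ⟨hI, hv⟩)
      obtain ⟨hi1, hi2⟩ := mem_link_singleton.mp hi
      rw [← link_deletion_singleton Δ (fun hiv => hi2 (by simp [hiv]))]
      exact (hdel i (Δ.lower (by simp) hi1)).link_singleton v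
    refine .of_vertex _ v (hpure.costar _) ⟨hvΔ, ?_⟩ ?_ ?_
    -- A second element `j` of the face is what keeps `v` a vertex of the costar; the costar of
    -- `{v}` alone has lost it.
    · obtain ⟨F, hF, hvF, hjF⟩ := h.exists_isFacet hvΔ (i := j) (by simpa using hjv)
      exact ⟨F, hF, hvF, fun hsub => hjF (hsub (Finset.mem_insert_of_mem hj))⟩
    · convert hdel v hvΔ using 1
      ext J
      change J ∈ (Δ.costar (insert v I)).deletion {v} ↔ J ∈ Δ.deletion {v}
      simp only [mem_costar, mem_deletion_singleton]
      constructor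
      · exact fun hJ => ⟨hJ.1.1, hJ.2⟩
      · rintro ⟨hJ, hvJ⟩
        obtain ⟨F, hF, hJF, hvF⟩ := h.exists_isFacet hJ hvJ
        exact ⟨⟨hJ, F, hF, hJF, fun hsub => hvF (hsub (Finset.mem_insert_self v I))⟩, hvJ⟩
    · convert hlink using 1
      ext J
      change J ∈ (Δ.costar (insert v I)).link {v} ↔ J ∈ (Δ.link {v}).costar I
      simp only [mem_costar, mem_link_singleton, isFacet_link_singleton_iff]
      constructor
      · rintro ⟨⟨hJ, F, hF, hJF, hIF⟩, hvJ⟩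
        have hvF : v ∈ F := hJF (Finset.mem_insert_self v J)
        refine ⟨⟨hJ, hvJ⟩, F.erase v,
          ⟨by rwa [Finset.insert_erase hvF], Finset.notMem_erase v F⟩,
          Finset.subset_erase.mpr ⟨(Finset.subset_insert v J).trans hJF, hvJ⟩, fun hsub => ?_⟩
        exact hIF (Finset.insert_subset hvF (hsub.trans (Finset.erase_subset v F)))
      · rintro ⟨⟨hJ, hvJ⟩, F, ⟨hF, hvF⟩, hJF, hIF⟩
        exact ⟨⟨hJ, insert v F, hF, Finset.insert_subset_insert v hJF,
          fun hsub => hIF ((Finset.insert_subset_insert_iff hv).mp hsub)⟩, hvJ⟩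

end FaceComplex

/-! ### The exchange condition, from a signed conjugation action. -/

namespace CoxeterSystem

variable {B W : Type*} [Group W] {M : CoxeterMatrix B}

open Classical in
/-- The action of a simple reflection `s` on `W × ℤ/2`: conjugation by `s` on the first factor,
where the sign is switched at the fixed point `s`. -/
noncomputable def signedConjSimple (cs : CoxeterSystem M W) (i : B) :
    Equiv.Perm (W × ZMod 2) where
  toFun p := (cs.simple i * p.1 * cs.simple i, p.2 + if p.1 = cs.simple i then 1 else 0)
  invFun p := (cs.simple i * p.1 * cs.simple i, p.2 + if p.1 = cs.simple i then 1 else 0)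
  left_inv p := by
    have h : cs.simple i * p.1 * cs.simple i = cs.simple i ↔ p.1 = cs.simple i := by
      constructor
      · intro h
        have := congrArg (fun x => cs.simple i * x * cs.simple i) h
        simpa [mul_assoc] using this
      · rintro h; simp [h]
    ext
    · simp [mul_assoc]
    · simp only [h, add_assoc, CharTwo.add_self_eq_zero, add_zero]
  right_inv p := by
    have h : cs.simple i * p.1 * cs.simple i = cs.simple i ↔ p.1 = cs.simple i := by
      constructor
      · intro h
        have := congrArg (fun x => cs.simple i * x * cs.simple i) h
        simpa [mul_assoc] using this
      · rintro h; simp [h]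
    ext
    · simp [mul_assoc]
    · simp only [h, add_assoc, CharTwo.add_self_eq_zero, add_zero]

open Classical in
theorem signedConjSimple_apply (cs : CoxeterSystem M W) (i : B) (t : W) (e : ZMod 2) :
    cs.signedConjSimple i (t, e) =
      (cs.simple i * t * cs.simple i, e + if t = cs.simple i then 1 else 0) := rfl

open Classical in
theorem signedConjSimple_mul_pow_apply (cs : CoxeterSystem M W) (i j : B) (k : ℕ) (t : W)
    (e : ZMod 2) :
    ((cs.signedConjSimple i * cs.signedConjSimple j) ^ k) (t, e) =
      ((cs.simple i * cs.simple j) ^ k * t * ((cs.simple i * cs.simple j) ^ k)⁻¹,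
        e + ∑ l ∈ Finset.range (2 * k),
          if t = cs.simple j * (cs.simple i * cs.simple j) ^ l then 1 else 0) := by
  induction k with
  | zero => simp
  | succ k ih =>
    obtain ⟨u, hu⟩ : ∃ u, u = cs.simple i * cs.simple j := ⟨_, rfl⟩
    rw [← hu] at ih ⊢
    have hinv : u⁻¹ = cs.simple j * cs.simple i := by simp [hu]
    have hsu (n : ℕ) : cs.simple j * u ^ n = (u ^ n)⁻¹ * cs.simple j := by
      have h : SemiconjBy (cs.simple j) u u⁻¹ := by
        rw [SemiconjBy, hinv, hu, mul_assoc]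
      rw [(h.pow_right n).eq, inv_pow]
    have h1 : u ^ k * t * (u ^ k)⁻¹ = cs.simple j ↔ t = cs.simple j * u ^ (2 * k) := by
      rw [two_mul, pow_add, ← mul_assoc, hsu, mul_inv_eq_iff_eq_mul, mul_assoc,
        ← eq_inv_mul_iff_mul_eq]
    have h2 : cs.simple j * (u ^ k * t * (u ^ k)⁻¹) * cs.simple j = cs.simple i ↔
        t = cs.simple j * u ^ (2 * k + 1) := by
      have : cs.simple j * (u ^ k * t * (u ^ k)⁻¹) * cs.simple j = cs.simple i ↔
          u ^ k * t * (u ^ k)⁻¹ = cs.simple j * u := by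
        constructor
        · intro h
          have := congrArg (fun x => cs.simple j * x * cs.simple j) h
          simpa [mul_assoc, hu] using this
        · intro h; rw [h, hu]; simp [mul_assoc]
      rw [this, two_mul, add_assoc, pow_add, ← mul_assoc, hsu, mul_inv_eq_iff_eq_mul, mul_assoc,
        ← eq_inv_mul_iff_mul_eq, pow_succ', mul_assoc]
    rw [pow_succ', Equiv.Perm.mul_apply, ih, Equiv.Perm.mul_apply, signedConjSimple_apply,
      signedConjSimple_apply]
    ext
    · simp only [pow_succ', mul_inv_rev, hinv]
      simp [mul_assoc, hu]
    · simp only [h1, h2]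
      rw [show 2 * (k + 1) = 2 * k + 1 + 1 by ring, Finset.sum_range_succ, Finset.sum_range_succ]
      simp only [add_assoc]

/-- With `k = M i j` the summand has period `M i j` in `l`, so each term occurs twice and the sign
vanishes mod 2. For infinite order, `M i j = 0` and the sum is empty. -/
theorem isLiftable_signedConjSimple (cs : CoxeterSystem M W) :
    M.IsLiftable cs.signedConjSimple := by
  classical
  intro i j
  ext1 ⟨t, e⟩
  rw [signedConjSimple_mul_pow_apply, cs.simple_mul_simple_pow, two_mul, Finset.sum_range_add]
  simp [pow_add, CharTwo.add_self_eq_zero]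

/-- The action of a Coxeter group on `W × ℤ/2` by conjugation with signs. -/
noncomputable def signedConj (cs : CoxeterSystem M W) : W →* Equiv.Perm (W × ZMod 2) :=
  cs.lift ⟨cs.signedConjSimple, cs.isLiftable_signedConjSimple⟩

open Classical in
-- The left side depends only on the group element, hence so does the parity of the multiplicity of
-- `t` in the right inversion sequence of any word for it.
theorem signedConj_wordProd (cs : CoxeterSystem M W) (ω : List B) (t : W) (e : ZMod 2) :
    cs.signedConj (cs.wordProd ω) (t, e) =
      (cs.wordProd ω * t * (cs.wordProd ω)⁻¹, e + ((cs.rightInvSeq ω).count t : ZMod 2)) := by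
  induction ω with
  | nil => simp
  | cons i ω ih =>
    have h : cs.wordProd ω * t * (cs.wordProd ω)⁻¹ = cs.simple i ↔
        (cs.wordProd ω)⁻¹ * cs.simple i * cs.wordProd ω = t := by
      rw [mul_inv_eq_iff_eq_mul, mul_assoc, inv_mul_eq_iff_eq_mul, eq_comm]
    rw [cs.wordProd_cons, map_mul, Equiv.Perm.mul_apply, ih, signedConj, cs.lift_apply_simple,
      signedConjSimple_apply, rightInvSeq, List.count_cons]
    ext
    · simp [mul_assoc]
    · simp only [h, beq_iff_eq]
      push_cast
      rw [add_assoc]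

/-- The exchange condition: if `s` is a right descent of the product of a word, then multiplying
by `s` amounts to omitting one letter. -/
theorem exists_wordProd_eq_mul_simple (cs : CoxeterSystem M W) {ω : List B} {i : B}
    (h : cs.IsRightDescent (cs.wordProd ω) i) :
    ∃ (ω₁ : List B) (j : B) (ω₂ : List B), ω = ω₁ ++ j :: ω₂ ∧
      cs.wordProd (ω₁ ++ ω₂) = cs.wordProd ω * cs.simple i := by
  classical
  -- A reduced word ending in `i` has `cs.simple i` exactly once in its right inversion sequence. By
  -- parity it also occurs for `ω`, and its position there is the letter to omit.
  obtain ⟨ω', hω', hprod⟩ := cs.exists_isReduced (cs.wordProd ω * cs.simple i)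
  have hw : cs.wordProd (ω'.concat i) = cs.wordProd ω := by
    rw [cs.wordProd_concat, ← hprod]; simp
  have hred : cs.IsReduced (ω'.concat i) := by
    rw [CoxeterSystem.IsReduced, hw, List.length_concat, ← hω'.eq, ← hprod]
    exact (cs.isRightDescent_iff.mp h).symm
  have hmem : cs.simple i ∈ cs.rightInvSeq (ω'.concat i) := by
    rw [cs.rightInvSeq_concat]; simp
  have hcount : (cs.rightInvSeq (ω'.concat i)).count (cs.simple i) = 1 :=
    List.count_eq_one_of_mem hred.nodup_rightInvSeq hmem
  have h1 := cs.signedConj_wordProd (ω'.concat i) (cs.simple i) 0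
  rw [hw, cs.signedConj_wordProd ω, hcount] at h1
  have h2 : ((cs.rightInvSeq ω).count (cs.simple i) : ZMod 2) = 1 := by
    simpa using congrArg Prod.snd h1
  have h3 : cs.simple i ∈ cs.rightInvSeq ω := by
    by_contra hn
    rw [List.count_eq_zero_of_not_mem hn] at h2
    exact absurd h2 (by decide)
  obtain ⟨k, hk, hk'⟩ := List.mem_iff_getElem.mp h3
  have hkω : k < ω.length := by simpa using hk
  refine ⟨ω.take k, ω[k], ω.drop (k + 1), by simp, ?_⟩
  rw [← List.eraseIdx_eq_take_drop_succ, ← cs.wordProd_mul_getD_rightInvSeq,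
    List.getD_eq_getElem _ _ hk, hk']

end CoxeterSystem

/-! ### Vertex decomposability of subword complexes. -/

namespace CoxeterSystem

open FaceComplex

variable {B W : Type*} [Group W] {M : CoxeterMatrix B}

theorem subword_insert_of_forall_lt {r : ℕ} (Q : Fin r → B) {A : Finset (Fin r)} {a : Fin r}
    (h : ∀ x ∈ A, x < a) : subword Q (insert a A) = subword Q A ++ [Q a] := by
  have key : (List.finRange r).filter (fun i => i ∈ insert a A) =
      (List.finRange r).filter (fun i => i ∈ A) ++ [a] := by
    have ha : a ∉ A := fun ha => lt_irrefl a (h a ha)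
    refine List.Perm.eq_of_pairwise (le := (· < ·)) (fun x y _ _ hxy hyx => absurd hxy hyx.asymm)
      ((List.pairwise_lt_finRange r).filter _)
      (List.pairwise_append.mpr ⟨(List.pairwise_lt_finRange r).filter _, by simp, ?_⟩) ?_
    · intro x hx y hy
      simp only [List.mem_filter, List.mem_finRange, true_and, decide_eq_true_eq,
        List.mem_singleton] at hx hy
      exact hy ▸ h x hx
    · refine (List.perm_ext_iff_of_nodup ((List.nodup_finRange r).filter _) ?_).mpr ?_
      · refine List.Nodup.append ((List.nodup_finRange r).filter _) (by simp) ?_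
        simpa [List.disjoint_singleton] using ha
      · intro x
        simp [or_comm]
  rw [subword, key, List.map_append, subword, List.map_singleton]

theorem exists_subword_erase {r : ℕ} {Q : Fin r → B} {A : Finset (Fin r)} {ω₁ ω₂ : List B} {b : B}
    (h : subword Q A = ω₁ ++ b :: ω₂) : ∃ x ∈ A, subword Q (A.erase x) = ω₁ ++ ω₂ := by
  obtain ⟨l₁, l', hl, rfl, h'⟩ := List.map_eq_append_iff.mp h
  obtain ⟨x, l₂, rfl, -, rfl⟩ := List.map_eq_cons_iff.mp h'
  have hnodup : (l₁ ++ x :: l₂).Nodup := hl ▸ (List.nodup_finRange r).filter _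
  have hx : x ∈ A := by
    have : x ∈ (List.finRange r).filter (fun i => i ∈ A) := by rw [hl]; simp
    simpa using this
  refine ⟨x, hx, ?_⟩
  have hx' : x ∉ l₁ ++ l₂ := (List.nodup_cons.mp (List.nodup_middle.mp hnodup)).1
  have : (List.finRange r).filter (fun i => i ∈ A.erase x) = l₁ ++ l₂ := by
    have h2 : (List.finRange r).filter (fun i => i ∈ A.erase x) =
        ((List.finRange r).filter (fun i => i ∈ A)).filter (fun i => i ≠ x) := by
      rw [List.filter_filter]
      congr 1
      ext i
      simp
    have h3 : (l₁ ++ l₂).filter (fun i => i ≠ x) = l₁ ++ l₂ :=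
      List.filter_eq_self.mpr fun i hi => by simpa using fun hix : i = x => hx' (hix ▸ hi)
    rw [h2, hl, ← h3, List.filter_append, List.filter_append]
    simp
  rw [subword, this, List.map_append]

theorem IsReducedExpression.length_eq {cs : CoxeterSystem M W} {ω : List B} {w : W}
    (h : cs.IsReducedExpression ω w) : ω.length = cs.length w := by
  rw [← h.2, h.1.eq]

theorem isReducedExpression_iff (cs : CoxeterSystem M W) {ω : List B} {w : W} :
    cs.IsReducedExpression ω w ↔ cs.wordProd ω = w ∧ ω.length = cs.length w :=
  ⟨fun h => ⟨h.2, h.length_eq⟩, fun h => ⟨by rw [CoxeterSystem.IsReduced, h.1, h.2], h.1⟩⟩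

theorem isReducedExpression_append_singleton_iff (cs : CoxeterSystem M W) {ω : List B} {i : B}
    {w : W} : cs.IsReducedExpression (ω ++ [i]) w ↔
      cs.IsRightDescent w i ∧ cs.IsReducedExpression ω (w * cs.simple i) := by
  simp only [isReducedExpression_iff, cs.wordProd_append, cs.wordProd_singleton,
    List.length_append, List.length_singleton]
  constructor
  · rintro ⟨h, hlen⟩
    have hω : cs.wordProd ω = w * cs.simple i := by rw [← h]; simp
    have h1 := cs.length_wordProd_le ω
    rw [hω] at h1
    have h2 := cs.length_mul_simple w i
    exact ⟨by rw [IsRightDescent]; lia, hω, by lia⟩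
  · rintro ⟨h, hω, hlen⟩
    rw [isRightDescent_iff] at h
    exact ⟨by rw [hω]; simp, by lia⟩

theorem length_subword {r : ℕ} (Q : Fin r → B) (A : Finset (Fin r)) :
    (subword Q A).length = A.card := by
  rw [subword, List.length_map, ← List.toFinset_card_of_nodup ((List.nodup_finRange r).filter _)]
  congr 1
  ext
  simp

/-- The subword complex of the subword of `Q` on the positions in `A`, as a complex on the
positions of `Q`. -/
def subwordComplexOn (cs : CoxeterSystem M W) {r : ℕ} (Q : Fin r → B) (A : Finset (Fin r))
    (w : W) : FaceComplex (Fin r) where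
  carrier := {J | ∃ I : Finset (Fin r), J ⊆ I ∧ I ⊆ A ∧ cs.IsReducedExpression (subword Q (A \ I)) w}
  lower' := fun _ _ hba ha => ha.imp fun _ hI => ⟨Finset.Subset.trans hba hI.1, hI.2⟩

theorem mem_subwordComplexOn {cs : CoxeterSystem M W} {r : ℕ} {Q : Fin r → B}
    {A J : Finset (Fin r)} {w : W} : J ∈ cs.subwordComplexOn Q A w ↔
      ∃ I : Finset (Fin r), J ⊆ I ∧ I ⊆ A ∧ cs.IsReducedExpression (subword Q (A \ I)) w := Iff.rfl

theorem subwordComplexOn_univ (cs : CoxeterSystem M W) {r : ℕ} (Q : Fin r → B) (w : W) :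
    cs.subwordComplexOn Q Finset.univ w = cs.subwordComplex Q w := by
  ext J
  change (∃ I : Finset (Fin r), _) ↔ (∃ I : Finset (Fin r), _)
  simp [Finset.compl_eq_univ_sdiff]

theorem isPure_subwordComplexOn (cs : CoxeterSystem M W) {r : ℕ} (Q : Fin r → B)
    (A : Finset (Fin r)) (w : W) : (cs.subwordComplexOn Q A w).IsPure := by
  have key : ∀ F : Finset (Fin r), (cs.subwordComplexOn Q A w).IsFacet F →
      F.card = A.card - cs.length w := by
    rintro F ⟨⟨I, hFI, hIA, hI⟩, hmax⟩
    obtain rfl : F = I := le_antisymm hFI (hmax (y := I) ⟨I, subset_rfl, hIA, hI⟩ hFI)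
    have h1 := hI.length_eq
    rw [length_subword, Finset.card_sdiff_of_subset hIA] at h1
    have := Finset.card_le_card hIA
    lia
  intro F G hF hG
  rw [key F hF, key G hG]

theorem link_subwordComplexOn_insert (cs : CoxeterSystem M W) {r : ℕ} (Q : Fin r → B)
    {A : Finset (Fin r)} {a : Fin r} (ha : a ∉ A) (w : W) :
    (cs.subwordComplexOn Q (insert a A) w).link {a} = cs.subwordComplexOn Q A w := by
  ext J
  change J ∈ (cs.subwordComplexOn Q (insert a A) w).link {a} ↔ J ∈ cs.subwordComplexOn Q A w
  simp only [mem_link_singleton, mem_subwordComplexOn]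
  constructor
  · rintro ⟨⟨I, hJI, hIA, hI⟩, haJ⟩
    have haI : a ∈ I := hJI (Finset.mem_insert_self a J)
    refine ⟨I.erase a, Finset.subset_erase.mpr ⟨(Finset.subset_insert a J).trans hJI, haJ⟩,
      Finset.subset_insert_iff.mp hIA, ?_⟩
    convert hI using 2
    grind
  · rintro ⟨I, hJI, hIA, hI⟩
    refine ⟨⟨insert a I, Finset.insert_subset_insert a hJI, Finset.insert_subset_insert a hIA, ?_⟩,
      fun haJ => ha (hIA (hJI haJ))⟩
    convert hI using 2
    grind

/-- If a facet omits the last position, its complement spells `w` reducedly up to and including `a`.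
If it contains `a`, the exchange condition trades `a` for a further position `x`, leaving a reduced
word for `w * cs.simple (Q a)`. -/
theorem deletion_subwordComplexOn_insert_of_isRightDescent (cs : CoxeterSystem M W) {r : ℕ}
    (Q : Fin r → B) {A : Finset (Fin r)} {a : Fin r} (ha : ∀ x ∈ A, x < a) {w : W}
    (hw : cs.IsRightDescent w (Q a)) :
    (cs.subwordComplexOn Q (insert a A) w).deletion {a} =
      cs.subwordComplexOn Q A (w * cs.simple (Q a)) := by
  have haA : a ∉ A := fun h => lt_irrefl a (ha a h)
  ext J
  change J ∈ (cs.subwordComplexOn Q (insert a A) w).deletion {a} ↔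
    J ∈ cs.subwordComplexOn Q A (w * cs.simple (Q a))
  simp only [mem_deletion_singleton, mem_subwordComplexOn]
  constructor
  · rintro ⟨⟨I, hJI, hIA, hI⟩, haJ⟩
    by_cases haI : a ∈ I
    · have hset : insert a A \ I = A \ I.erase a := by grind
      rw [hset] at hI
      obtain ⟨ω₁, b, ω₂, hω, hprod⟩ :=
        cs.exists_wordProd_eq_mul_simple (ω := subword Q (A \ I.erase a)) (hI.2.symm ▸ hw)
      obtain ⟨x, hx, hsub⟩ := exists_subword_erase hω
      have hxA := (Finset.mem_sdiff.mp hx).1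
      refine ⟨insert x (I.erase a), ?_, ?_, ?_⟩
      · exact (Finset.subset_erase.mpr ⟨hJI, haJ⟩).trans (Finset.subset_insert _ _)
      · exact Finset.insert_subset hxA (Finset.subset_insert_iff.mp hIA)
      · have : A \ insert x (I.erase a) = (A \ I.erase a).erase x := by grind
        rw [this, isReducedExpression_iff, hsub, hprod, hI.2]
        refine ⟨rfl, ?_⟩
        have h1 := hI.length_eq
        rw [hω] at h1
        have h2 := cs.isRightDescent_iff.mp hw
        simp only [List.length_append, List.length_cons] at h1 ⊢
        lia
    · have hset : insert a A \ I = insert a (A \ I) := by grind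
      rw [hset, subword_insert_of_forall_lt Q (fun x hx => ha x (Finset.mem_sdiff.mp hx).1),
        isReducedExpression_append_singleton_iff] at hI
      exact ⟨I, hJI, by grind, hI.2⟩
  · rintro ⟨I, hJI, hIA, hI⟩
    have haI : a ∉ I := fun h => haA (hIA h)
    have hset : insert a A \ I = insert a (A \ I) := by grind
    refine ⟨⟨I, hJI, hIA.trans (Finset.subset_insert a A), ?_⟩, fun h => haI (hJI h)⟩
    rw [hset, subword_insert_of_forall_lt Q (fun x hx => ha x (Finset.mem_sdiff.mp hx).1),
      isReducedExpression_append_singleton_iff]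
    exact ⟨hw, hI⟩

/-- No reduced expression of `w` ends in `Q a`, so every facet contains `a`: the complex is a cone,
and deletion and link of the apex agree. -/
theorem deletion_subwordComplexOn_insert_of_not_isRightDescent (cs : CoxeterSystem M W) {r : ℕ}
    (Q : Fin r → B) {A : Finset (Fin r)} {a : Fin r} (ha : ∀ x ∈ A, x < a) {w : W}
    (hw : ¬ cs.IsRightDescent w (Q a)) :
    (cs.subwordComplexOn Q (insert a A) w).deletion {a} = cs.subwordComplexOn Q A w := by
  have haA : a ∉ A := fun h => lt_irrefl a (ha a h)
  rw [← cs.link_subwordComplexOn_insert Q haA w]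
  ext J
  change J ∈ (cs.subwordComplexOn Q (insert a A) w).deletion {a} ↔
    J ∈ (cs.subwordComplexOn Q (insert a A) w).link {a}
  simp only [mem_deletion_singleton, mem_link_singleton]
  refine and_congr_left fun _ => ⟨?_, fun h => LowerSet.lower _ (Finset.subset_insert a J) h⟩
  rintro ⟨I, hJI, hIA, hI⟩
  refine ⟨I, Finset.insert_subset ?_ hJI, hIA, hI⟩
  by_contra haI
  have hset : insert a A \ I = insert a (A \ I) := by grind
  rw [hset, subword_insert_of_forall_lt Q (fun x hx => ha x (Finset.mem_sdiff.mp hx).1),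
    isReducedExpression_append_singleton_iff] at hI
  exact hw hI.1

theorem vertexDecomposable_subwordComplexOn (cs : CoxeterSystem M W) {r : ℕ} (Q : Fin r → B)
    (A : Finset (Fin r)) (w : W) : (cs.subwordComplexOn Q A w).VertexDecomposable := by
  induction A using Finset.induction_on_max generalizing w with
  | empty =>
    refine .of_isSimplex _ ?_
    by_cases h : cs.IsReducedExpression (subword Q ∅) w
    · refine Or.inr ⟨∅, ?_⟩
      ext J
      change J ∈ cs.subwordComplexOn Q ∅ w ↔ J ⊆ ∅
      exact ⟨fun ⟨I, hJI, hI, _⟩ => hJI.trans hI, fun hJ => ⟨∅, hJ, subset_rfl, by simpa using h⟩⟩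
    · refine Or.inl ?_
      ext J
      change J ∈ cs.subwordComplexOn Q ∅ w ↔ False
      exact iff_of_false (fun ⟨I, _, _, hI⟩ => h (by simpa using hI)) id
  | insert a A ha ih =>
    have hdel : ((cs.subwordComplexOn Q (insert a A) w).deletion {a}).VertexDecomposable := by
      by_cases hw : cs.IsRightDescent w (Q a)
      · rw [cs.deletion_subwordComplexOn_insert_of_isRightDescent Q ha hw]
        exact ih _
      · rw [cs.deletion_subwordComplexOn_insert_of_not_isRightDescent Q ha hw]
        exact ih _
    by_cases hmem : {a} ∈ cs.subwordComplexOn Q (insert a A) w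
    · refine .of_vertex _ a (cs.isPure_subwordComplexOn Q _ w) hmem hdel ?_
      rw [cs.link_subwordComplexOn_insert Q (fun h => lt_irrefl a (ha a h))]
      exact ih _
    · rwa [deletion_singleton_eq_self hmem] at hdel

theorem isPure_subwordComplex (cs : CoxeterSystem M W) {r : ℕ} (Q : Fin r → B) (w : W) :
    (cs.subwordComplex Q w).IsPure :=
  cs.subwordComplexOn_univ Q w ▸ cs.isPure_subwordComplexOn Q _ w

/-- Subword complexes are vertex decomposable. -/
theorem vertexDecomposable_subwordComplex (cs : CoxeterSystem M W) {r : ℕ} (Q : Fin r → B)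
    (w : W) : (cs.subwordComplex Q w).VertexDecomposable :=
  cs.subwordComplexOn_univ Q w ▸ cs.vertexDecomposable_subwordComplexOn Q _ w

end CoxeterSystem

/-! ### The no-retraction theorem, by volumes. -/

open Polynomial in
-- The determinant of `1 + t • A` is a polynomial in `t` of degree at most the size of `A`. The
-- interpolation weights do not depend on `A`, so the identity can later be integrated over a family
-- of matrices.
theorem Matrix.det_one_add_eq_sum_lagrange {m : Type*} [Fintype m] [DecidableEq m]
    (A : Matrix m m ℝ) {ι : Type*} [DecidableEq ι] (s : Finset ι) (v : ι → ℝ)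
    (hv : Set.InjOn v s) (hs : Fintype.card m < s.card) :
    (1 + A).det =
      ∑ k ∈ s, (1 + v k • A).det * (Lagrange.basis s v k).eval 1 := by
  set P : ℝ[X] := ((X : ℝ[X]) • A.map C + (1 : Matrix m m ℝ).map C).det with hP
  have heval (t : ℝ) : P.eval t = (1 + t • A).det := by
    rw [hP, ← coe_evalRingHom, RingHom.map_det]
    congr 1
    ext i j
    by_cases hij : i = j <;> simp [hij, add_comm, mul_comm t]
  have hdeg : P.degree < s.card :=
    degree_le_natDegree.trans_lt (by
      exact_mod_cast (Polynomial.natDegree_det_X_add_C_le A 1).trans_lt hs)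
  have h := congrArg (eval 1) (Lagrange.eq_interpolate hv hdeg)
  rw [Lagrange.interpolate_apply, eval_finsetSum] at h
  simpa [heval] using h

theorem ContinuousLinearMap.det_id_add_eq_sum_lagrange {E : Type*} [NormedAddCommGroup E]
    [NormedSpace ℝ E] [FiniteDimensional ℝ E] (A : E →L[ℝ] E) {ι : Type*} [DecidableEq ι]
    (s : Finset ι) (v : ι → ℝ) (hv : Set.InjOn v s) (hs : Module.finrank ℝ E < s.card) :
    (.id ℝ _ + A).det = ∑ k ∈ s, (.id ℝ _ + v k • A).det * (Lagrange.basis s v k).eval 1 := by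
  let b := Module.finBasis ℝ E
  have hdet (t : ℝ) : (.id ℝ _ + t • A).det = (1 + t • LinearMap.toMatrix b b A.toLinearMap).det := by
    rw [ContinuousLinearMap.det, ← LinearMap.det_toMatrix b]
    congr 1
    simp
  have h := Matrix.det_one_add_eq_sum_lagrange (LinearMap.toMatrix b b A.toLinearMap) s v hv
    (by simpa using hs)
  have h1 := hdet 1
  rw [one_smul, one_smul] at h1
  simp only [hdet, h1, h]

/-- Let `r` be a self-map of a closed ball that fixes the boundary sphere and is a Lipschitz
perturbation of the identity. The maps on the line between the identity and `r` are bijections of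
the open ball as long as they are close to the identity. -/
theorem injOn_and_image_ball_add_smul {E : Type*} [NormedAddCommGroup E] [NormedSpace ℝ E]
    [FiniteDimensional ℝ E] {r : E → E} {R : ℝ} (hR : 0 < R) {K : NNReal}
    (hK : LipschitzOnWith K (fun x => r x - x) (Metric.closedBall 0 R)) (hr : ∀ x, ‖r x‖ ≤ R)
    (hfix : ∀ x, ‖x‖ = R → r x = x) {t : ℝ} (ht0 : 0 ≤ t) (ht1 : t < 1) (htK : t * K < 1) :
    Set.InjOn (fun x => x + t • (r x - x)) (Metric.ball 0 R) ∧
      (fun x => x + t • (r x - x)) '' Metric.ball 0 R = Metric.ball 0 R := by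
  set f : E → E := fun x => x + t • (r x - x) with hf
  have happ' : ApproximatesLinearOn f (ContinuousLinearEquiv.refl ℝ E : E →L[ℝ] E)
      (Metric.closedBall 0 R) (t.toNNReal * K) := by
    intro x hx y hy
    have h := hK.norm_sub_le hx hy
    have : f x - f y - (ContinuousLinearEquiv.refl ℝ E : E →L[ℝ] E) (x - y) =
        t • ((r x - x) - (r y - y)) := by
      simp only [hf, ContinuousLinearEquiv.coe_coe, ContinuousLinearEquiv.coe_refl']
      simp only [id_eq]
      module
    rw [this, norm_smul, Real.norm_of_nonneg ht0, NNReal.coe_mul, Real.coe_toNNReal t ht0,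
      mul_assoc]
    gcongr
  have happ := happ'.mono_set Metric.ball_subset_closedBall
  have hc : Subsingleton E ∨ t.toNNReal * K <
      ‖((ContinuousLinearEquiv.refl ℝ E).symm : E →L[ℝ] E)‖₊⁻¹ := by
    obtain h | h := subsingleton_or_nontrivial E
    · exact Or.inl h
    · right
      have : ‖((ContinuousLinearEquiv.refl ℝ E).symm : E →L[ℝ] E)‖₊ = 1 :=
        ContinuousLinearMap.nnnorm_id
      rw [this, inv_one, ← NNReal.coe_lt_coe, NNReal.coe_mul, Real.coe_toNNReal t ht0]
      exact htK
  have hsub : f '' Metric.ball 0 R ⊆ Metric.ball 0 R := by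
    rintro _ ⟨x, hx, rfl⟩
    rw [mem_ball_zero_iff] at hx ⊢
    have : f x = (1 - t) • x + t • r x := by simp only [hf]; module
    rw [this]
    calc _ ≤ (1 - t) * ‖x‖ + t * ‖r x‖ := by
          refine (norm_add_le _ _).trans ?_
          rw [norm_smul, norm_smul, Real.norm_of_nonneg ht0, Real.norm_of_nonneg (by linarith)]
      _ < R := by nlinarith [hr x]
  refine ⟨happ.injOn hc, hsub.antisymm ?_⟩
  -- The image is open, and relatively closed in the ball: a limit point is the image of a point of
  -- the closed ball, and boundary points are fixed, hence do not land inside.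
  refine IsPreconnected.subset_of_closure_inter_subset (convex_ball 0 R).isPreconnected
    (happ.open_image (ContinuousLinearEquiv.refl ℝ E).toNonlinearRightInverse
      Metric.isOpen_ball hc) ?_ ?_
  · have h0 : f 0 ∈ f '' Metric.ball 0 R := Set.mem_image_of_mem f (Metric.mem_ball_self hR)
    exact ⟨f 0, hsub h0, h0⟩
  · rintro y ⟨hy, hyR⟩
    have hcl : IsClosed (f '' Metric.closedBall 0 R) :=
      ((isCompact_closedBall 0 R).image_of_continuousOn happ'.continuousOn).isClosed
    obtain ⟨x, hx, rfl⟩ := closure_minimal (Set.image_mono Metric.ball_subset_closedBall) hcl hy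
    rw [mem_closedBall_zero_iff] at hx
    obtain hx | hx := hx.lt_or_eq
    · exact ⟨x, by simpa using hx, rfl⟩
    · simp [hf, hfix x hx, hx] at hyR

/-- Along the segment from the identity the maps stay injective, so the determinant cannot change
sign. -/
theorem ContinuousLinearMap.det_id_add_pos_of_norm_lt_one {E : Type*} [NormedAddCommGroup E]
    [NormedSpace ℝ E] [FiniteDimensional ℝ E] {A : E →L[ℝ] E} (hA : ‖A‖ < 1) :
    0 < (.id ℝ E + A).det := by
  have hne (s : ℝ) (hs : s ∈ Set.Icc (0 : ℝ) 1) : (.id ℝ E + s • A).det ≠ 0 := by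
    intro h
    obtain ⟨v, hv, hv0⟩ := (Submodule.ne_bot_iff _).mp (LinearMap.bot_lt_ker_of_det_eq_zero h).ne'
    have hv' : v = -(s • A v) := eq_neg_of_add_eq_zero_left (by simpa using hv)
    have h1 : ‖v‖ ≤ ‖A‖ * ‖v‖ := calc
      ‖v‖ = s * ‖A v‖ := by
        conv_lhs => rw [hv', norm_neg, norm_smul, Real.norm_of_nonneg hs.1]
      _ ≤ 1 * ‖A v‖ := by gcongr; exact hs.2
      _ ≤ ‖A‖ * ‖v‖ := by rw [one_mul]; exact A.le_opNorm v
    nlinarith [norm_pos_iff.mpr hv0]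
  have hcont : Continuous fun s : ℝ => (.id ℝ E + s • A).det :=
    ContinuousLinearMap.continuous_det.comp (by fun_prop)
  by_contra! hle
  obtain ⟨s, hs, hs0⟩ := intermediate_value_Icc' zero_le_one hcont.continuousOn
    (show (0 : ℝ) ∈ _ from ⟨by simpa using hle, by simp [ContinuousLinearMap.det]⟩)
  exact hne s hs hs0

open MeasureTheory in
/-- There is no differentiable retraction of a ball onto its boundary sphere. -/
theorem not_exists_contDiff_retraction {E : Type*} [NormedAddCommGroup E]
    [InnerProductSpace ℝ E] [FiniteDimensional ℝ E] {R : ℝ} (hR : 0 < R) {r : E → E} (hr : ContDiff ℝ 1 r)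
    (hnorm : ∀ x, ‖r x‖ = R) (hfix : ∀ x, ‖x‖ = R → r x = x) : False := by
  borelize E
  have hφ : ContDiff ℝ 1 fun x => r x - x := hr.sub contDiff_id
  obtain ⟨K, hK⟩ := hφ.contDiffOn.exists_lipschitzOnWith (s := Metric.closedBall (0 : E) R) one_ne_zero
    (convex_closedBall 0 R) (isCompact_closedBall 0 R)
  set φ' : E → E →L[ℝ] E := fderiv ℝ fun x => r x - x with hφ'
  have hφ'c : Continuous φ' := hφ.continuous_fderiv one_ne_zero
  have hderiv (x : E) : HasFDerivAt (fun x => r x - x) (φ' x) x :=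
    (hφ.differentiable one_ne_zero x).hasFDerivAt
  -- For small `t` the integrand is the positive Jacobian of a bijection of the ball.
  have hvol (t : ℝ) (ht0 : 0 ≤ t) (ht1 : t < 1) (htK : t * K < 1) :
      ∫ x in Metric.ball (0 : E) R, (.id ℝ E + t • φ' x).det = volume.real (Metric.ball (0 : E) R) := by
    obtain ⟨hinj, himage⟩ := injOn_and_image_ball_add_smul hR hK (fun x => (hnorm x).le) hfix ht0 ht1 htK
    have h := integral_image_eq_integral_abs_det_fderiv_smul (μ := volume)
      (f' := fun x => .id ℝ E + t • φ' x) Metric.isOpen_ball.measurableSet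
      (fun x _ => ((hasFDerivAt_id x).add ((hderiv x).const_smul t)).hasFDerivWithinAt) hinj
      (fun _ => (1 : ℝ))
    rw [himage] at h
    simp only [smul_eq_mul, mul_one, setIntegral_const] at h
    rw [h]
    refine setIntegral_congr_fun Metric.isOpen_ball.measurableSet fun x hx => ?_
    refine (abs_of_pos (ContinuousLinearMap.det_id_add_pos_of_norm_lt_one ?_)).symm
    have hx' : ‖φ' x‖ ≤ K := norm_fderiv_le_of_lipschitzOn ℝ
      (Metric.closedBall_mem_nhds_of_mem hx) hK
    rw [norm_smul, Real.norm_of_nonneg ht0]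
    exact (mul_le_mul_of_nonneg_left hx' ht0).trans_lt htK
  -- Since `‖r‖ ^ 2` is constant, the image of the derivative at `x` is orthogonal to `r x ≠ 0`, so
  -- the derivative is not onto.
  have hzero (x : E) : (.id ℝ E + φ' x).det = 0 := by
    by_contra hdet
    have hr' : HasFDerivAt r (.id ℝ E + φ' x) x := by
      convert (hasFDerivAt_id x).add (hderiv x)
      ext1 y
      simp
    have h1 := hr'.norm_sq
    simp only [hnorm] at h1
    have h2 := h1.unique (hasFDerivAt_const (R ^ 2) x)
    have hsurj : Function.Surjective (.id ℝ E + φ' x : E →L[ℝ] E) :=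
      (LinearMap.equivOfDetNeZero _ hdet).surjective
    obtain ⟨u, hu⟩ := hsurj (r x)
    have h3 := congrArg (fun L => L u) h2
    simp only [smul_apply, ContinuousLinearMap.comp_apply, hu] at h3
    simp [hnorm, hR.ne'] at h3
  obtain ⟨v, hv, hvmem⟩ : ∃ v : ℕ → ℝ, Function.Injective v ∧
      ∀ k, 0 ≤ v k ∧ v k < 1 ∧ v k * K < 1 := by
    refine ⟨fun k => 1 / ((K + 1) * (k + 2)), ?_, fun k => ⟨by positivity, ?_, ?_⟩⟩
    · intro k l hkl
      have : (K : ℝ) + 1 ≠ 0 := by positivity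
      field_simp at hkl
      exact_mod_cast (add_right_cancel hkl).symm
    · rw [div_lt_one (by positivity)]
      nlinarith [K.2, (k.cast_nonneg : (0 : ℝ) ≤ k)]
    · rw [div_mul_eq_mul_div, div_lt_one (by positivity)]
      nlinarith [K.2, (k.cast_nonneg : (0 : ℝ) ≤ k)]
  have hint (t : ℝ) : IntegrableOn (fun x => (.id ℝ E + t • φ' x).det) (Metric.ball (0 : E) R) := by
    refine IntegrableOn.mono_set (Continuous.continuousOn ?_ |>.integrableOn_compact
      (isCompact_closedBall 0 R)) Metric.ball_subset_closedBall
    exact ContinuousLinearMap.continuous_det.comp (by fun_prop)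
  have hs : Module.finrank ℝ E < (Finset.range (Module.finrank ℝ E + 1)).card := by simp
  have h1 : (0 : ℝ) = ∫ x in Metric.ball (0 : E) R, (.id ℝ E + φ' x).det := by simp [hzero]
  have h2 : (fun x => (.id ℝ E + φ' x).det) = _ :=
    funext fun x => ContinuousLinearMap.det_id_add_eq_sum_lagrange (φ' x) _ v hv.injOn hs
  rw [h2] at h1
  rw [integral_finsetSum _ fun k _ => (hint (v k)).mul_const _] at h1
  simp_rw [integral_mul_const] at h1
  simp_rw [fun k => hvol (v k) (hvmem k).1 (hvmem k).2.1 (hvmem k).2.2] at h1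
  -- The weights sum to 1, so the constancy of the integral for small `t` carries over to `t = 1`,
  -- where the integrand vanishes.
  rw [← Finset.mul_sum, ← Polynomial.eval_finsetSum,
    Lagrange.sum_basis hv.injOn (by simp), Polynomial.eval_one, mul_one] at h1
  exact h1.not_lt (ENNReal.toReal_pos (Metric.measure_ball_pos _ _ hR).ne' measure_ball_lt_top.ne)

/-! ### Spheres are not contractible. -/

open Metric in
/-- A nullhomotopy of the identity of the unit sphere extends the identity outside the unit ball
to a map that has no zero. -/
theorem exists_continuous_one_le_norm_of_nullhomotopic {E : Type*} [NormedAddCommGroup E]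
    [NormedSpace ℝ E] (h : (ContinuousMap.id (sphere (0 : E) 1)).Nullhomotopic) :
    ∃ f : E → E, Continuous f ∧ (∀ x, 1 ≤ ‖f x‖) ∧ ∀ x, 1 ≤ ‖x‖ → f x = x := by
  classical
  obtain ⟨p, ⟨H⟩⟩ := h
  have hmem (x : E) (hx : x ≠ 0) : ‖x‖⁻¹ • x ∈ sphere (0 : E) 1 := by
    simp [norm_smul, hx]
  -- The homotopy is run along the radius: its time is 0 for `‖x‖ ≥ 1` and 1 for `‖x‖ ≤ 1/2`. Thus
  -- `f` is constant near the origin, where the direction of `x` is undefined.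
  let f : E → E := fun x => if hx : x = 0 then p else
    max 1 ‖x‖ • (H (Set.projIcc 0 1 zero_le_one (2 - 2 * ‖x‖), ⟨‖x‖⁻¹ • x, hmem x hx⟩) : E)
  have hf0 (x : E) (hx : x ≠ 0) : f x = max 1 ‖x‖ •
      (H (Set.projIcc 0 1 zero_le_one (2 - 2 * ‖x‖), ⟨‖x‖⁻¹ • x, hmem x hx⟩) : E) := dif_neg hx
  refine ⟨f, continuous_iff_continuousAt.mpr fun x => ?_, fun x => ?_, fun x hx => ?_⟩
  · obtain rfl | hx := eq_or_ne x 0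
    · refine (continuousAt_const (y := (p : E))).congr ?_
      filter_upwards [ball_mem_nhds (0 : E) (one_half_pos (α := ℝ))] with y hy
      rw [mem_ball_zero_iff] at hy
      by_cases hy0 : y = 0
      · simp [f, hy0]
      · rw [hf0 y hy0, Set.projIcc_of_right_le _ (by linarith), max_eq_left (by linarith), one_smul]
        have := H.apply_one ⟨‖y‖⁻¹ • y, hmem y hy0⟩
        exact congrArg Subtype.val this.symm
    · have hcont : ContinuousOn f {0}ᶜ := by
        rw [continuousOn_iff_continuous_domRestrict]
        have : ({0}ᶜ : Set E).domRestrict f = fun x : ({0}ᶜ : Set E) => max 1 ‖(x : E)‖ •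
            (H (Set.projIcc 0 1 zero_le_one (2 - 2 * ‖(x : E)‖),
              ⟨‖(x : E)‖⁻¹ • (x : E), hmem x x.2⟩) : E) := funext fun x => hf0 x x.2
        rw [this]
        have hinv : Continuous fun x : ({0}ᶜ : Set E) => ‖(x : E)‖⁻¹ :=
          (by fun_prop : Continuous fun x : ({0}ᶜ : Set E) => ‖(x : E)‖).inv₀
            fun x => norm_ne_zero_iff.mpr x.2
        have hproj : Continuous fun x : ({0}ᶜ : Set E) =>
            Set.projIcc (0 : ℝ) 1 zero_le_one (2 - 2 * ‖(x : E)‖) :=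
          continuous_projIcc.comp (by fun_prop)
        refine (by fun_prop : Continuous fun x : ({0}ᶜ : Set E) => max 1 ‖(x : E)‖).smul
          (continuous_subtype_val.comp (H.continuous.comp (hproj.prodMk ?_)))
        exact (hinv.smul continuous_subtype_val).subtype_mk _
      exact hcont.continuousAt (isOpen_compl_singleton.mem_nhds hx)
  · by_cases hx : x = 0
    · simp [f, hx]
    · rw [hf0 x hx, norm_smul, norm_eq_of_mem_sphere, mul_one]
      exact (le_max_left 1 ‖x‖).trans (le_abs_self _)
  · have hx0 : x ≠ 0 := norm_pos_iff.mp (by linarith)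
    rw [hf0 x hx0, Set.projIcc_of_le_left _ (by linarith), max_eq_right hx]
    have := H.apply_zero ⟨‖x‖⁻¹ • x, hmem x hx0⟩
    change H (0, _) = _ at this
    change ‖x‖ • (H (0, _) : E) = x
    rw [this]
    simp [smul_smul, hx0]

open Metric in
/-- The unit sphere in a Euclidean space is not contractible. -/
theorem not_nullhomotopic_id_sphere {E : Type*} [NormedAddCommGroup E] [InnerProductSpace ℝ E]
    [FiniteDimensional ℝ E] : ¬ (ContinuousMap.id (sphere (0 : E) 1)).Nullhomotopic := by
  intro h
  obtain ⟨f, hf, hf1, hfid⟩ := exists_continuous_one_le_norm_of_nullhomotopic h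
  have hopen : IsOpen {x : E | 1 < ‖x‖} := isOpen_lt continuous_const continuous_norm
  have hclosed : IsClosed {x : E | 2 ≤ ‖x‖} := isClosed_le continuous_const continuous_norm
  have hsub : {x : E | 2 ≤ ‖x‖} ⊆ {x : E | 1 < ‖x‖} := fun x (hx : 2 ≤ ‖x‖) =>
    show 1 < ‖x‖ by linarith
  -- An error below `1/2` keeps `g` away from zero. Radius 2 leaves room, since exact agreement on a
  -- closed set needs `f` smooth on a neighbourhood of it.
  obtain ⟨g, hg, hdist, hgf, -⟩ := hf.exists_contDiff_approx_and_eqOn (ε := fun _ => 1 / 2) 1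
    continuous_const (fun _ => by norm_num) hclosed
    (hopen.mem_nhdsSet.mpr hsub) (contDiff_id.contDiffOn.congr fun x (hx : 1 < ‖x‖) => hfid x hx.le)
  have hg0 (x : E) : g x ≠ 0 := by
    intro hgx
    have h1 := hdist x
    rw [hgx, dist_zero_left] at h1
    linarith [hf1 x]
  refine not_exists_contDiff_retraction (r := fun x => (2 * ‖g x‖⁻¹) • g x) two_pos ?_ ?_ ?_
  · exact (contDiff_const.mul ((hg.norm ℝ hg0).inv fun x => norm_ne_zero_iff.mpr (hg0 x))).smul hg
  · intro x
    simp [norm_smul, hg0 x]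
  · intro x hx
    have : g x = x := (hgf hx.ge).trans (hfid x (by linarith))
    simp [this, hx]

open Metric in
-- Stereographic projection from the missed point factors the map through a vector space, which is
-- contractible.
theorem ContinuousMap.nullhomotopic_of_notMem_range_sphere {X E : Type*} [TopologicalSpace X]
    [NormedAddCommGroup E] [InnerProductSpace ℝ E] (g : C(X, sphere (0 : E) 1))
    {q : sphere (0 : E) 1} (hq : q ∉ Set.range g) : g.Nullhomotopic := by
  have hq1 : ‖(q : E)‖ = 1 := norm_eq_of_mem_sphere q
  let s := stereographic hq1
  have hmem (x : X) : g x ∈ s.source := by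
    rw [stereographic_source]
    exact fun hx => hq ⟨x, hx⟩
  let f : C(X, (ℝ ∙ (q : E))ᗮ) := ⟨fun x => s (g x), s.continuousOn.comp_continuous g.continuous hmem⟩
  let f' : C((ℝ ∙ (q : E))ᗮ, sphere (0 : E) 1) :=
    ⟨s.symm, continuousOn_univ.mp (stereographic_target hq1 ▸ s.continuousOn_symm)⟩
  have hg : g = f'.comp f := ContinuousMap.ext fun x => (s.left_inv (hmem x)).symm
  rw [hg]
  exact ((id_nullhomotopic _).comp_left f).comp_right f'

/-- A space on which the identity is homotopic to a map that is not onto is no sphere. -/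
theorem ContinuousMap.Homotopic.isEmpty_homeomorph_sphere {X E : Type*} [TopologicalSpace X]
    [NormedAddCommGroup E] [InnerProductSpace ℝ E] [FiniteDimensional ℝ E] {g : C(X, X)}
    (hg : (ContinuousMap.id X).Homotopic g) {q : X} (hq : q ∉ Set.range g) :
    IsEmpty (X ≃ₜ Metric.sphere (0 : E) 1) := by
  refine ⟨fun h => not_nullhomotopic_id_sphere (E := E) ?_⟩
  have h1 : ((h : C(X, Metric.sphere (0 : E) 1)).comp g).Nullhomotopic := by
    refine ContinuousMap.nullhomotopic_of_notMem_range_sphere _ (q := h q) ?_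
    rintro ⟨x, hx⟩
    exact hq ⟨x, h.injective hx⟩
  obtain ⟨y, hy⟩ := h1.comp_left (h.symm : C(Metric.sphere (0 : E) 1, X))
  refine ⟨y, ContinuousMap.Homotopic.trans ?_ hy⟩
  have h2 := (((ContinuousMap.Homotopic.refl (h : C(X, Metric.sphere (0 : E) 1))).comp hg).comp
    (ContinuousMap.Homotopic.refl (h.symm : C(Metric.sphere (0 : E) 1, X))))
  convert h2
  ext x
  simp

/-! ### Ridges of spherical complexes. -/

namespace FaceComplex

theorem mem_realization {V : Type*} [Fintype V] [DecidableEq V] {Δ : FaceComplex V}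
    {x : V → ℝ} :
    x ∈ Δ.realization ↔ (∀ j, 0 ≤ x j) ∧ ∑ j, x j = 1 ∧ ∃ I ∈ Δ, ∀ j ∉ I, x j = 0 := by
  simp only [realization, Set.mem_iUnion, exists_prop]
  constructor
  · rintro ⟨I, hI, hx⟩
    have hconv : Convex ℝ {y : V → ℝ | (∀ j, 0 ≤ y j) ∧ ∑ j, y j = 1 ∧ ∀ j ∉ I, y j = 0} := by
      rintro y ⟨hy0, hy1, hyI⟩ z ⟨hz0, hz1, hzI⟩ a b ha hb hab
      refine ⟨fun j => ?_, ?_, fun j hj => by simp [hyI j hj, hzI j hj]⟩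
      · have := hy0 j
        have := hz0 j
        simp only [Pi.add_apply, Pi.smul_apply, smul_eq_mul]
        positivity
      · simp [Finset.sum_add_distrib, ← Finset.mul_sum, hy1, hz1, hab]
    have hmem := convexHull_min (t := {y : V → ℝ | (∀ j, 0 ≤ y j) ∧ ∑ j, y j = 1 ∧ ∀ j ∉ I, y j = 0})
      ?_ hconv hx
    · exact ⟨hmem.1, hmem.2.1, I, hI, hmem.2.2⟩
    · rintro _ ⟨i, hi, rfl⟩
      refine ⟨fun j => ?_, by simp, fun j hj => ?_⟩
      · by_cases hij : j = i <;> simp [hij]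
      · exact Pi.single_eq_of_ne (by rintro rfl; exact hj hi) _
  · rintro ⟨h0, h1, I, hI, hxI⟩
    refine ⟨I, hI, ?_⟩
    have hsum : ∑ j ∈ I, x j = 1 := by
      rw [← h1]
      exact Finset.sum_subset (Finset.subset_univ I) fun j _ hj => hxI j hj
    have hx : x = ∑ j ∈ I, x j • (Pi.single j 1 : V → ℝ) := by
      ext k
      by_cases hk : k ∈ I <;> simp [Finset.sum_apply, Pi.single_apply, hk, hxI]
    rw [hx]
    exact (convex_convexHull ℝ _).sum_mem (fun j _ => h0 j) hsum
      fun j hj => subset_convexHull ℝ _ ⟨j, hj, rfl⟩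

/-- If a facet `F` is the only facet that contains the ridge `F \ {i}`, then the identity of the
realization is homotopic to a map that is not onto. -/
theorem exists_homotopic_notMem_range {V : Type*} [Fintype V] [DecidableEq V] {Δ : FaceComplex V}
    {F : Finset V} (hF : F ∈ Δ) {i : V} (hi : i ∈ F)
    (hfree : ∀ G ∈ Δ, F.erase i ⊆ G → G ⊆ F) (hne : (F.erase i).Nonempty) :
    ∃ g : C(Δ.realization, Δ.realization), (ContinuousMap.id Δ.realization).Homotopic g ∧
      ∃ q, q ∉ Set.range g := by
  set R := F.erase i with hR
  have hiR : i ∉ R := Finset.notMem_erase i F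
  -- The flow moves weight `m x` from each vertex of the ridge to `i`, with total weight preserved.
  -- Points whose support misses part of the ridge have `m x = 0` and stay put; all others lie in
  -- the simplex on `F`, by freeness.
  let m : (V → ℝ) → ℝ := fun x => R.inf' hne x
  have hm : Continuous m := Continuous.finset_inf'_apply hne fun j _ => continuous_apply j
  let d : V → ℝ := fun j => if j = i then (R.card : ℝ) else if j ∈ R then -1 else 0
  have hdi : d i = R.card := by simp [d]
  have hdR (j : V) (hj : j ∈ R) : d j = -1 := by
    have : j ≠ i := fun hji => hiR (hji ▸ hj)
    simp [d, hj, this]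
  have hd0 (j : V) (hj : j ∉ F) : d j = 0 := by
    have h1 : j ≠ i := fun hji => hj (hji ▸ hi)
    have h2 : j ∉ R := fun h => hj (Finset.mem_of_mem_erase h)
    simp [d, h1, h2]
  have hdsum : ∑ j, d j = 0 := by
    rw [← Finset.sum_subset (Finset.subset_univ F) fun j _ hj => hd0 j hj,
      ← Finset.add_sum_erase F d hi, hdi, Finset.sum_congr rfl hdR]
    simp
  have hmem (t : unitInterval) (x : Δ.realization) :
      (x : V → ℝ) + ((t : ℝ) * m x) • d ∈ Δ.realization := by
    obtain ⟨h0, h1, I, hI, hxI⟩ := mem_realization.mp x.2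
    have hmle (j : V) (hj : j ∈ R) : m x ≤ x.1 j := Finset.inf'_le _ hj
    have hm0 : 0 ≤ m x := Finset.le_inf' _ _ fun j _ => h0 j
    refine mem_realization.mpr ⟨fun j => ?_, ?_, ?_⟩
    · simp only [Pi.add_apply, Pi.smul_apply, smul_eq_mul]
      have htm : 0 ≤ (t : ℝ) * m x := mul_nonneg t.2.1 hm0
      by_cases hj : j ∈ R
      · rw [hdR j hj]
        nlinarith [hmle j hj, t.2.2]
      · have : 0 ≤ d j := by
          simp only [d, hj, if_false]
          split_ifs <;> positivity
        have := h0 j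
        positivity
    · simp [Finset.sum_add_distrib, ← Finset.mul_sum, h1, hdsum]
    · obtain hm0 | hm0 := hm0.eq_or_lt
      · exact ⟨I, hI, by simpa [← hm0] using hxI⟩
      · have hRI : R ⊆ I := fun j hj => by
          by_contra hjI
          linarith [hmle j hj, hxI j hjI]
        refine ⟨F, hF, fun j hj => ?_⟩
        simp [hd0 j hj, hxI j fun hjI => hj (hfree I hI hRI hjI)]
  let H : unitInterval × Δ.realization → Δ.realization := fun p =>
    ⟨(p.2 : V → ℝ) + ((p.1 : ℝ) * m p.2) • d, hmem p.1 p.2⟩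
  have hH : Continuous H := by
    have hm' : Continuous fun p : unitInterval × Δ.realization => m p.2 :=
      hm.comp (continuous_subtype_val.comp continuous_snd)
    exact Continuous.subtype_mk (by fun_prop) _
  refine ⟨⟨fun x => H (1, x), by fun_prop⟩, ⟨⟨⟨H, hH⟩, fun x => ?_, fun x => rfl⟩⟩, ?_⟩
  · exact Subtype.ext (by simp [H])
  -- The barycentre of the ridge is missed: at time 1 the minimal ridge coordinate has become 0.
  · have hcard : (R.card : ℝ) ≠ 0 := by exact_mod_cast hne.card_pos.ne'
    refine ⟨⟨fun j => if j ∈ R then (R.card : ℝ)⁻¹ else 0,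
      mem_realization.mpr ⟨fun j => ?_, ?_, R, Δ.lower (Finset.erase_subset i F) hF, ?_⟩⟩, ?_⟩
    · split_ifs <;> positivity
    · simp [hcard]
    · intro j hj
      simp [hj]
    · rintro ⟨x, hx⟩
      obtain ⟨j, hj, hjm⟩ := R.exists_mem_eq_inf' hne x.1
      have h1 := congrFun (congrArg Subtype.val hx) j
      have hmj : m x = x.1 j := hjm
      simp [H, hdR j hj, hmj, hj] at h1
      exact hcard h1.symm

theorem IsSpherical.hasOppositeFacets {V : Type*} [Fintype V] [DecidableEq V] {Δ : FaceComplex V}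
    (h : Δ.IsSpherical) : Δ.HasOppositeFacets := by
  intro F hF i hi
  by_contra! hno
  obtain ⟨-, n, ⟨e⟩⟩ := h
  have hfree : ∀ G ∈ Δ, F.erase i ⊆ G → G ⊆ F := by
    intro G hG hFG
    obtain ⟨G', hG', hGG'⟩ := exists_isFacet_superset hG
    have hiG' := hno G' hG' (hFG.trans hGG')
    have hFG' : F ⊆ G' := by
      rw [← Finset.insert_erase hi]
      exact Finset.insert_subset hiG' (hFG.trans hGG')
    exact hGG'.trans (hF.2 hG'.1 hFG')
  -- With an empty ridge there is nothing to push, but the realization is then a single point, whose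
  -- identity map is constant.
  obtain hne | hne := (F.erase i).eq_empty_or_nonempty
  · have hFi : F = {i} := by rw [← Finset.insert_erase hi, hne, LawfulSingleton.insert_empty_eq]
    have hreal (x : Δ.realization) : x.1 = Pi.single i 1 := by
      obtain ⟨-, h1, I, hI, hxI⟩ := mem_realization.mp x.2
      have hx0 (j : V) (hj : j ≠ i) : x.1 j = 0 := by
        refine hxI j fun hjI => hj ?_
        simpa [hFi] using hfree I hI (by simp [hne]) hjI
      rw [Finset.sum_eq_single i (fun j _ hj => hx0 j hj) (by simp)] at h1
      ext j
      by_cases hj : j = i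
      · rw [hj, h1, Pi.single_eq_same]
      · rw [hx0 j hj, Pi.single_eq_of_ne hj]
    have hmem : (Pi.single i 1 : V → ℝ) ∈ Δ.realization := by
      refine mem_realization.mpr ⟨fun j => ?_, by simp, F, hF.1, fun j hj => ?_⟩
      · by_cases hj : j = i <;> simp [hj]
      · exact Pi.single_eq_of_ne (by rintro rfl; exact hj hi) _
    have hsub : Subsingleton Δ.realization :=
      ⟨fun x y => Subtype.ext ((hreal x).trans (hreal y).symm)⟩
    have := e.symm.injective.subsingleton
    let p := e ⟨_, hmem⟩
    refine not_nullhomotopic_id_sphere (E := EuclideanSpace ℝ (Fin n)) ?_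
    convert ContinuousMap.nullhomotopic_of_constant p
    exact Subsingleton.elim _ _
  · obtain ⟨g, hg, q, hq⟩ := exists_homotopic_notMem_range hF.1 hi hfree hne
    exact hg.isEmpty_homeomorph_sphere hq |>.false e

end FaceComplex

/-! ### The equivalence. -/

theorem mainTheorem7 :
    (∀ (B : Type u) (W : Type v) [Finite B] [Group W] [Infinite W] (M : CoxeterMatrix B)
        (cs : CoxeterSystem M W) (r : ℕ) (Q : Fin r → B) (w : W),
        (cs.subwordComplex Q w).IsSpherical →
          ∀ i : Fin r, {i} ∈ cs.subwordComplex Q w →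
            ((cs.subwordComplex Q w).deletion {i}).VertexDecomposable) ↔
    (∀ (B : Type u) (W : Type v) [Finite B] [Group W] [Infinite W] (M : CoxeterMatrix B)
        (cs : CoxeterSystem M W) (r : ℕ) (Q : Fin r → B) (w : W),
        (cs.subwordComplex Q w).IsSpherical →
          (cs.subwordComplex Q w).StronglyVertexDecomposable) := by
  constructor
  · intro h B W _ _ _ M cs r Q w hsph I hI
    exact ⟨hsph.hasOppositeFacets.vertexDecomposable_costar (cs.isPure_subwordComplex Q w)
      (h B W M cs r Q w hsph) hI, (cs.vertexDecomposable_subwordComplex Q w).star hI⟩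
  · intro h B W _ _ _ M cs r Q w hsph i hi
    rw [← hsph.hasOppositeFacets.costar_singleton i]
    exact (h B W M cs r Q w hsph {i} hi).1
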